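/- Setting. Fix $n>2$. $Ty_n$ is classical, extensional higher-order logic (simple type theory) whose types are built from the truth type $t$ and individual types $e_1,\dots,e_n$ by function types $(\alpha\beta)$ (functions from $\alpha$ to $\beta$, associated to the right) and product types $\alpha\times\beta$. Its terms are built from variables and constants by application, $\lambda$-abstraction, equality, pairing and projections, and it has a description operator $\iota_{(\alpha t)\alpha}$ with $\vdash\iota_{(\alpha t)\alpha}\,\lambda x_\alpha(y_\alpha=x_\alpha)=y_\alpha$ at every type $\alpha$. Write $s:=e_n$ and $c:=e_{n-1}$. Let $\mathcal A=\{a_1,\dots,a_N\}$ be a finite alphabet. $Ty_n^{\mathcal A}$ is $Ty_n$, with some family of non-logical constants that includes distinct constants $C^0_s,\dots,C^N_s$ and a constant $C^0_{sss}$ (written as $+$), together with the axioms $\forall x_s(x+C^0_s=x\wedge C^0_s+x=x)$, $\forall x_s\forall y_s\forall z_s\,((x+y)+z=x+(y+z))$ and $\forall x_s\forall y_s\forall z_s\,(x+C^i_s+y\ne x+C^j_s+z)$ for $1\le i<j\le N$. $Ty_n^{\mathcal A+}$ is an extension of $Ty_n^{\mathcal A}$ by additional non-logical constants. For $w\in\mathcal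 A^*$ let $T_A(\varepsilon)=C^0_s$, $T_A(a_i)=C^i_s$, and $T_A(a_iw)=C^i_s+T_A(w)$ for $w\neq\varepsilon$. Let $\mathcal T_\alpha$ be the set of $Ty_n^{\mathcal A}$ terms of type $\alpha$. For a term $B$ of type $\alpha$, $(=B)$ stands for $\lambda x_\alpha(x_\alpha=B)$, and disjunctions of predicates are pointwise. Below, $\vdash$ without assumptions is provability in $Ty_n^{\mathcal A}$, and $\Delta\vdash$ is derivability from $\Delta$ in $Ty_n^{\mathcal A+}$. An $\alpha$-language is a relation $\mathcal L\subset\mathcal A^*\times\mathcal T_\alpha$. Given a set $\Delta$ of $Ty_n^{\mathcal A+}$ formulas and a $Ty_n^{\mathcal A+}$ term $L$ of type $s\alpha t$, the pair $(\Delta,L)$ is a *pseudo-canonic representation* of $\mathcal L$ if 1. $\Delta$ is consistent and, for all $w\in\mathcal A^*$ and $A\in\mathcal T_\alpha$, $(w,A)\in\mathcal L\iff\Delta\vdash L\,T_A(w)\,A$ (that is, $(\Delta,L)$ represents $\mathcal L$); 2. for every $w\in\mathcal A^*$ there is a finite, possibly empty, set $\{A^1,\dots,A^l\}\subset\mathcal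 T_\alpha$ with $\Delta\vdash L\,T_A(w)=\bigvee_{i=1}^l(=A^i)$ (the right side being $\lambda x_\alpha\,\mathsf F$ if $l=0$); 3. $\Delta$ is conservative over $Ty_n^{\mathcal A}$: for every $Ty_n^{\mathcal A}$ formula $A_t$, $\vdash A_t$ iff $\Delta\vdash A_t$. Put $\bar\alpha:=c(c\times\alpha)$. A *context-dependent $\alpha$-language* is an $\bar\alpha$-language. Terms of type $\bar\alpha$ are identified with pairs of terms of types $cc$ and $c\alpha$: the pair $(x_{cc},y_{c\alpha})$ corresponds to $\lambda z_c(x_{cc}z_c,\,y_{c\alpha}z_c)$, and $p_{\bar\alpha}$ corresponds to $(\lambda z_c\,\pi_1(p\,z_c),\ \lambda z_c\,\pi_2(p\,z_c))$; functions of a pair are identified with functions of two arguments. For a context-dependent $\alpha$-language $\mathcal L$ and a $Ty_n^{\mathcal A}$ term $C_c$ of type $c$, the *context instantiation* of $\mathcal L$ is the $\alpha$-language $$\mathcal L\downarrow C_c:=\{(w,B)\;:\;\text{there is }A\in\mathcal T_{\bar\alpha}\text{ with }(w,A)\in\mathcal L\text{ and }\vdash CI(C_c)\,A\,B\},$$ where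 $CI(C_c):=\lambda x_{cc}\lambda y_{c\alpha}(=y_{c\alpha}\,C_c)$. Define also the $Ty_n^{\mathcal A}$ term $$(\downarrow_{(s\bar\alpha t)cs\alpha t}):=\lambda z_{s\bar\alpha t}\,\lambda z_c\,\lambda x_s\,\lambda y_\alpha\,\exists x_{cc}\,\exists y_{c\alpha}\,\bigl(z_{s\bar\alpha t}\,x_s\,x_{cc}\,y_{c\alpha}\ \wedge\ y_\alpha=y_{c\alpha}\,z_c\bigr),$$ and write $L\downarrow C_c$ for this term applied to $L$ and $C_c$. **Proposition 9.3.** Let $\mathcal L$ be a context-dependent $\alpha$-language, let $(\Delta,L_{s\bar\alpha t})$ be a pseudo-canonic representation of $\mathcal L$, and let $C_c$ be a $Ty_n^{\mathcal A}$ term of type $c$. Then $(\Delta,\,L_{s\bar\alpha t}\downarrow C_c)$ is a pseudo-canonic representation of the context instantiation $\mathcal L\downarrow C_c$. -/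

import Mathlib

/-! ## The sorted type theory `Ty_n` with products and descriptions -/

universe u v

namespace TyN

/-- Types over `n` sorts of individuals: the truth type `t`, the individual types `e i`
(`i : Fin n`, counted from `0`), functional types and product types. -/
inductive Ty (n : ℕ) : Type
  | t : Ty n
  | e : Fin n → Ty n
  | fn : Ty n → Ty n → Ty n
  | prod : Ty n → Ty n → Ty n

/-- `α ⇒ β` is the type of functions from `α` to `β`. -/
infixr:60 " ⇒ " => Ty.fn
/-- `α ⊠ β` is the type of pairs. -/
infixr:70 " ⊠ " => Ty.prod

/-- The symbolic type: the last individual type `e_n`. -/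
abbrev Ty.s {n : ℕ} [h : Fact (2 < n)] : Ty n := Ty.e ⟨n - 1, by have := h.out; omega⟩

/-- The context type: the last but one individual type `e_{n-1}`. -/
abbrev Ty.c {n : ℕ} [h : Fact (2 < n)] : Ty n := Ty.e ⟨n - 2, by have := h.out; omega⟩

/-- The type `c(c × α)` of the meanings of a context-dependent `α`-language. -/
abbrev Ty.ctx {n : ℕ} [Fact (2 < n)] (α : Ty n) : Ty n := Ty.c ⇒ (Ty.c ⊠ α)

/-- De Bruijn indices of type `α` into the list `Γ` of the types of the enclosing binders. -/
inductive BVar {n : ℕ} : List (Ty n) → Ty n → Type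
  | zero {Γ : List (Ty n)} {α : Ty n} : BVar (α :: Γ) α
  | succ {Γ : List (Ty n)} {α β : Ty n} : BVar Γ α → BVar (β :: Γ) α

/-- Well-typed terms over the family `K` of constants.  Free variables are named: `fvar i` at
type `α` is the variable `x^i_α`.  Bound variables are de Bruijn indices, so that terms which differ
only in the names of bound variables are identified; `Γ` lists the types of the binders in whose
scope the term stands.  The terms of the theory in the usual sense are those with `Γ = []`.
`iota` is the description operator, of type `(αt)α`. -/
inductive Term {n : ℕ} (K : Ty n → Type u) : List (Ty n) → Ty n → Type u
  | bvar {Γ : List (Ty n)} {α : Ty n} : BVar Γ α → Term K Γ α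
  | fvar {Γ : List (Ty n)} {α : Ty n} : ℕ → Term K Γ α
  | const {Γ : List (Ty n)} {α : Ty n} : K α → Term K Γ α
  | app {Γ : List (Ty n)} {α β : Ty n} : Term K Γ (α ⇒ β) → Term K Γ α → Term K Γ β
  | lam {Γ : List (Ty n)} {α β : Ty n} : Term K (α :: Γ) β → Term K Γ (α ⇒ β)
  | eq {Γ : List (Ty n)} {α : Ty n} : Term K Γ α → Term K Γ α → Term K Γ Ty.t
  | pair {Γ : List (Ty n)} {α β : Ty n} : Term K Γ α → Term K Γ β → Term K Γ (α ⊠ β)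
  | fst {Γ : List (Ty n)} {α β : Ty n} : Term K Γ (α ⊠ β) → Term K Γ α
  | snd {Γ : List (Ty n)} {α β : Ty n} : Term K Γ (α ⊠ β) → Term K Γ β
  | iota {Γ : List (Ty n)} {α : Ty n} : Term K Γ ((α ⇒ Ty.t) ⇒ α)

namespace Term

variable {n : ℕ} {K : Ty n → Type u}

/-! ### Renaming and capture-free substitution of bound variables -/

/-- A renaming, extended under one more binder. -/
def liftRen {Γ Δ : List (Ty n)} (ρ : ∀ α : Ty n, BVar Γ α → BVar Δ α) (β : Ty n) :
    ∀ α : Ty n, BVar (β :: Γ) α → BVar (β :: Δ) α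
  | _, .zero => .zero
  | _, .succ x => .succ (ρ _ x)

def rename : ∀ {Γ Δ : List (Ty n)}, (∀ α : Ty n, BVar Γ α → BVar Δ α) →
    ∀ {α : Ty n}, Term K Γ α → Term K Δ α
  | _, _, ρ, _, .bvar x => .bvar (ρ _ x)
  | _, _, _, _, .fvar i => .fvar i
  | _, _, _, _, .const k => .const k
  | _, _, ρ, _, .app f a => .app (f.rename ρ) (a.rename ρ)
  | _, _, ρ, _, .lam b => .lam (b.rename (liftRen ρ _))
  | _, _, ρ, _, .eq a b => .eq (a.rename ρ) (b.rename ρ)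
  | _, _, ρ, _, .pair a b => .pair (a.rename ρ) (b.rename ρ)
  | _, _, ρ, _, .fst p => .fst (p.rename ρ)
  | _, _, ρ, _, .snd p => .snd (p.rename ρ)
  | _, _, _, _, .iota => .iota

/-- The same term, placed under one more binder (which it does not mention). -/
def weaken {Γ : List (Ty n)} {α β : Ty n} (a : Term K Γ α) : Term K (β :: Γ) α :=
  a.rename fun _ x => .succ x

/-- There are no indices into the empty list. -/
def emptyRen {Γ : List (Ty n)} : ∀ α : Ty n, BVar [] α → BVar Γ α := nofun

/-- A term without dangling indices, placed under arbitrary binders. -/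
def lift {Γ : List (Ty n)} {α : Ty n} (a : Term K [] α) : Term K Γ α :=
  a.rename emptyRen

/-- A substitution, extended under one more binder. -/
def liftSubst {Γ Δ : List (Ty n)} (σ : ∀ α : Ty n, BVar Γ α → Term K Δ α) (β : Ty n) :
    ∀ α : Ty n, BVar (β :: Γ) α → Term K (β :: Δ) α
  | _, .zero => .bvar .zero
  | _, .succ x => (σ _ x).weaken

def subst : ∀ {Γ Δ : List (Ty n)}, (∀ α : Ty n, BVar Γ α → Term K Δ α) →
    ∀ {α : Ty n}, Term K Γ α → Term K Δ α
  | _, _, σ, _, .bvar x => σ _ x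
  | _, _, _, _, .fvar i => .fvar i
  | _, _, _, _, .const k => .const k
  | _, _, σ, _, .app f a => .app (f.subst σ) (a.subst σ)
  | _, _, σ, _, .lam b => .lam (b.subst (liftSubst σ _))
  | _, _, σ, _, .eq a b => .eq (a.subst σ) (b.subst σ)
  | _, _, σ, _, .pair a b => .pair (a.subst σ) (b.subst σ)
  | _, _, σ, _, .fst p => .fst (p.subst σ)
  | _, _, σ, _, .snd p => .snd (p.subst σ)
  | _, _, _, _, .iota => .iota

/-- The substitution that replaces the index `0` by `b` and lowers the other indices. -/
def instSubst {Γ : List (Ty n)} {β : Ty n} (b : Term K Γ β) :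
    ∀ α : Ty n, BVar (β :: Γ) α → Term K Γ α
  | _, .zero => b
  | _, .succ x => .bvar x

/-- `a.inst b` is the result of substituting `b` for the outermost bound variable of `a`. -/
def inst {Γ : List (Ty n)} {α β : Ty n} (a : Term K (β :: Γ) α) (b : Term K Γ β) : Term K Γ α :=
  a.subst (instSubst b)

/-- Translation of terms along a map of constants. -/
def mapConst {K' : Ty n → Type v} (f : ∀ α : Ty n, K α → K' α) :
    ∀ {Γ : List (Ty n)} {α : Ty n}, Term K Γ α → Term K' Γ α
  | _, _, .bvar x => .bvar x
  | _, _, .fvar i => .fvar i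
  | _, _, .const k => .const (f _ k)
  | _, _, .app g a => .app (g.mapConst f) (a.mapConst f)
  | _, _, .lam b => .lam (b.mapConst f)
  | _, _, .eq a b => .eq (a.mapConst f) (b.mapConst f)
  | _, _, .pair a b => .pair (a.mapConst f) (b.mapConst f)
  | _, _, .fst p => .fst (p.mapConst f)
  | _, _, .snd p => .snd (p.mapConst f)
  | _, _, .iota => .iota

/-! ### Logical connectives, defined from equality -/

variable {Γ : List (Ty n)}

/-- `T` is `(λ x_t, x_t) = (λ x_t, x_t)`. -/
def tt : Term K Γ Ty.t := .eq (.lam (α := Ty.t) (.bvar .zero)) (.lam (.bvar .zero))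

/-- `F` is `(λ x_t, T) = (λ x_t, x_t)`. -/
def ff : Term K Γ Ty.t := .eq (.lam (α := Ty.t) tt) (.lam (.bvar .zero))

/-- `¬ a` is `a = F`. -/
def neg (a : Term K Γ Ty.t) : Term K Γ Ty.t := .eq a ff

/-- `a ∧ b` is `(λ g_{ttt}, g T T) = (λ g_{ttt}, g a b)`. -/
def and (a b : Term K Γ Ty.t) : Term K Γ Ty.t :=
  .eq (.lam (α := Ty.t ⇒ Ty.t ⇒ Ty.t) (.app (.app (.bvar .zero) tt) tt))
    (.lam (.app (.app (.bvar .zero) a.weaken) b.weaken))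

/-- `a ∨ b` is `¬ (¬ a ∧ ¬ b)`. -/
def or (a b : Term K Γ Ty.t) : Term K Γ Ty.t := neg (and (neg a) (neg b))

/-- `∀ x_α, a` is `(λ x_α, T) = (λ x_α, a)`. -/
def all (α : Ty n) (a : Term K (α :: Γ) Ty.t) : Term K Γ Ty.t := .eq (.lam tt) (.lam a)

/-- `∃ x_α, a` is `¬ ∀ x_α, ¬ a`. -/
def ex (α : Ty n) (a : Term K (α :: Γ) Ty.t) : Term K Γ Ty.t := neg (all α (neg a))

/-- The predicate `(= a)`, that is `λ x_α, x_α = a`. -/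
def eqTo {α : Ty n} (a : Term K Γ α) : Term K Γ (α ⇒ Ty.t) := .lam (.eq (.bvar .zero) a.weaken)

/-- Disjunction of predicates, `λ x_α, p x_α ∨ q x_α`. -/
def predOr {α : Ty n} (p q : Term K Γ (α ⇒ Ty.t)) : Term K Γ (α ⇒ Ty.t) :=
  .lam (or (.app p.weaken (.bvar .zero)) (.app q.weaken (.bvar .zero)))

/-- `(= a₁) ∨ … ∨ (= a_l)` for a finite list of terms; `λ x_α, F` for the empty list. -/
def eqAny {α : Ty n} (l : List (Term K Γ α)) : Term K Γ (α ⇒ Ty.t) :=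
  l.foldr (fun a p => predOr (eqTo a) p) (.lam ff)

end Term

/-! ### Provability -/

/-- `Prov H A`: the formula `A` is derivable from the finite list `H` of assumptions in the pure
theory (classical higher-order logic with extensionality, descriptions and pairs).  Rule R of the
equational presentation of type theory is split into `leibniz` and `xi`; `propExt` and `boolCases`
say that the truth type has exactly the values `T` and `F`. -/
inductive Prov {n : ℕ} {K : Ty n → Type u} :
    ∀ {Γ : List (Ty n)}, List (Term K Γ Ty.t) → Term K Γ Ty.t → Prop
  | hyp {Γ : List (Ty n)} {H : List (Term K Γ Ty.t)} {A : Term K Γ Ty.t} : A ∈ H → Prov H A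
  | refl {Γ : List (Ty n)} {H : List (Term K Γ Ty.t)} {α : Ty n} (a : Term K Γ α) :
      Prov H (.eq a a)
  /-- Equals may be substituted for equals. -/
  | leibniz {Γ : List (Ty n)} {H : List (Term K Γ Ty.t)} {α : Ty n} {a b : Term K Γ α}
      (P : Term K (α :: Γ) Ty.t) : Prov H (.eq a b) → Prov H (P.inst a) → Prov H (P.inst b)
  /-- Equals may be substituted for equals under a binder whose variable is not free in `H`. -/
  | xi {Γ : List (Ty n)} {H : List (Term K Γ Ty.t)} {α β : Ty n} {a b : Term K (α :: Γ) β} :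
      Prov (H.map Term.weaken) (.eq a b) → Prov H (.eq (.lam a) (.lam b))
  | beta {Γ : List (Ty n)} {H : List (Term K Γ Ty.t)} {α β : Ty n} (a : Term K (α :: Γ) β)
      (b : Term K Γ α) : Prov H (.eq (.app (.lam a) b) (a.inst b))
  | eta {Γ : List (Ty n)} {H : List (Term K Γ Ty.t)} {α β : Ty n} (f : Term K Γ (α ⇒ β)) :
      Prov H (.eq (.lam (.app f.weaken (.bvar .zero))) f)
  | propExt {Γ : List (Ty n)} {H : List (Term K Γ Ty.t)} {A B : Term K Γ Ty.t} :
      Prov (A :: H) B → Prov (B :: H) A → Prov H (.eq A B)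
  | boolCases {Γ : List (Ty n)} {H : List (Term K Γ Ty.t)} (P : Term K (Ty.t :: Γ) Ty.t)
      (A : Term K Γ Ty.t) : Prov H (P.inst .tt) → Prov H (P.inst .ff) → Prov H (P.inst A)
  | fst_pair {Γ : List (Ty n)} {H : List (Term K Γ Ty.t)} {α β : Ty n} (a : Term K Γ α)
      (b : Term K Γ β) : Prov H (.eq (.fst (.pair a b)) a)
  | snd_pair {Γ : List (Ty n)} {H : List (Term K Γ Ty.t)} {α β : Ty n} (a : Term K Γ α)
      (b : Term K Γ β) : Prov H (.eq (.snd (.pair a b)) b)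
  | pair_eta {Γ : List (Ty n)} {H : List (Term K Γ Ty.t)} {α β : Ty n} (p : Term K Γ (α ⊠ β)) :
      Prov H (.eq (.pair (.fst p) (.snd p)) p)
  /-- The description of `λ x_α, a = x_α` is `a`. -/
  | descr {Γ : List (Ty n)} {H : List (Term K Γ Ty.t)} {α : Ty n} (a : Term K Γ α) :
      Prov H (.eq (.app .iota (.lam (.eq a.weaken (.bvar .zero)))) a)

/-! ## The symbolic extension over a finite alphabet -/

/-- The non-logical constants of the theory over the alphabet `Fin N`: any family of constants with
distinct distinguished constants `C^0_s, …, C^N_s` and a constant `C^0_{sss}`. -/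
structure Sig (n N : ℕ) [Fact (2 < n)] where
  Const : Ty n → Type u
  sym : Fin (N + 1) ↪ Const Ty.s
  cat : Const (Ty.s ⇒ Ty.s ⇒ Ty.s)

namespace Sig

variable {n N : ℕ} [Fact (2 < n)]

/-- The extension by a family `D` of additional constants. -/
def extend (S : Sig.{u} n N) (D : Ty n → Type v) : Sig.{max u v} n N where
  Const α := S.Const α ⊕ D α
  sym := S.sym.trans ⟨Sum.inl, Sum.inl_injective⟩
  cat := Sum.inl S.cat

/-- The set `T_α` of terms of type `α`. -/
abbrev Tm (S : Sig.{u} n N) (α : Ty n) : Type u := Term S.Const [] α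

/-- A term of the original theory, regarded as a term of the extended one. -/
def incl (S : Sig.{u} n N) (D : Ty n → Type v) {α : Ty n} (a : S.Tm α) : (S.extend D).Tm α :=
  a.mapConst fun _ k => Sum.inl k

variable (S : Sig.{u} n N)

/-- The symbol `C^i_s`. -/
def symTm {Γ : List (Ty n)} (i : Fin (N + 1)) : Term S.Const Γ Ty.s := .const (S.sym i)

/-- `a + b`, that is `C^0_{sss} a b`. -/
def catTm {Γ : List (Ty n)} (a b : Term S.Const Γ Ty.s) : Term S.Const Γ Ty.s :=
  .app (.app (.const S.cat) a) b

/-- `∀ x_s, (x + C^0 = x) ∧ (C^0 + x = x)`. -/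
def axUnit : S.Tm Ty.t :=
  .all Ty.s (.and (.eq (S.catTm (.bvar .zero) (S.symTm 0)) (.bvar .zero))
    (.eq (S.catTm (S.symTm 0) (.bvar .zero)) (.bvar .zero)))

/-- `∀ x_s, ∀ y_s, ∀ z_s, (x + y) + z = x + (y + z)`. -/
def axAssoc : S.Tm Ty.t :=
  .all Ty.s (.all Ty.s (.all Ty.s
    (.eq (S.catTm (S.catTm (.bvar (.succ (.succ .zero))) (.bvar (.succ .zero))) (.bvar .zero))
      (S.catTm (.bvar (.succ (.succ .zero))) (S.catTm (.bvar (.succ .zero)) (.bvar .zero))))))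

/-- `∀ x_s, ∀ y_s, ∀ z_s, x + C^i + y ≠ x + C^j + z`. -/
def axDistinct (i j : Fin (N + 1)) : S.Tm Ty.t :=
  .all Ty.s (.all Ty.s (.all Ty.s
    (.neg (.eq
      (S.catTm (S.catTm (.bvar (.succ (.succ .zero))) (S.symTm i)) (.bvar (.succ .zero)))
      (S.catTm (S.catTm (.bvar (.succ (.succ .zero))) (S.symTm j)) (.bvar .zero))))))

/-- The non-logical axioms of the theory (all of them are sentences). -/
def symAx : Set (S.Tm Ty.t) :=
  {S.axUnit, S.axAssoc} ∪ {A | ∃ i j : Fin (N + 1), 1 ≤ (i : ℕ) ∧ i < j ∧ A = S.axDistinct i j}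

/-- `Δ ⊢ A` in the theory with the constants `S` and the non-logical axioms above. -/
def Derives (Δ : Set (S.Tm Ty.t)) (A : S.Tm Ty.t) : Prop :=
  ∃ H : List (S.Tm Ty.t), (∀ B ∈ H, B ∈ S.symAx ∪ Δ) ∧ Prov H A

def Consistent (Δ : Set (S.Tm Ty.t)) : Prop := ¬ S.Derives Δ .ff

/-- The term `T_A(w)` for a word `w`; the letter `a_i` (`i = 1, …, N`) is `i - 1 : Fin N`. -/
def wordTm : List (Fin N) → S.Tm Ty.s
  | [] => S.symTm 0
  | [a] => S.symTm a.succ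
  | a :: b :: w => S.catTm (S.symTm a.succ) (wordTm (b :: w))

/-! ## Languages and their representations -/

/-- An `α`-language: a relation between words and terms of type `α`. -/
abbrev Lang (α : Ty n) : Type u := Set (List (Fin N) × S.Tm α)

/-- A context-dependent `α`-language. -/
abbrev CtxLang (α : Ty n) : Type u := S.Lang (Ty.ctx α)

/-- A semantic rule. -/
abbrev SemRule (α β : Ty n) : Type u := Set (S.Tm α × S.Tm β)

variable {S}

/-- Application of a semantic rule to a language. -/
def Lang.applyRule {α β : Ty n} (L : S.Lang α) (R : S.SemRule α β) : S.Lang β :=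
  {q | ∃ A : S.Tm α, (q.1, A) ∈ L ∧ (A, q.2) ∈ R}

/-- The semantic rule represented by a term `R_{αβt}`: the pairs `(A, B)` with `⊢ R A B`. -/
def SemRule.ofTerm {α β : Ty n} (R : S.Tm (α ⇒ β ⇒ Ty.t)) : S.SemRule α β :=
  {q | S.Derives ∅ (.app (.app R q.1) q.2)}

/-- `L` is represented by `(Δ, P)`, where `Δ` and `P` may use the additional constants `D`. -/
def Lang.RepresentedBy {D : Ty n → Type v} {α : Ty n} (L : S.Lang α)
    (Δ : Set ((S.extend D).Tm Ty.t)) (P : (S.extend D).Tm (Ty.s ⇒ α ⇒ Ty.t)) : Prop :=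
  (S.extend D).Consistent Δ ∧
    ∀ (w : List (Fin N)) (A : S.Tm α),
      (w, A) ∈ L ↔
        (S.extend D).Derives Δ (.app (.app P ((S.extend D).wordTm w)) (S.incl D A))

variable (S) in
/-- Adding `Δ` to the extended theory is conservative over the original theory. -/
def Conservative {D : Ty n → Type v} (Δ : Set ((S.extend D).Tm Ty.t)) : Prop :=
  ∀ A : S.Tm Ty.t, S.Derives ∅ A ↔ (S.extend D).Derives Δ (S.incl D A)

/-- `(Δ, P)` is a pseudo-canonic representation of `L`. -/
def Lang.PseudoCanonic {D : Ty n → Type v} {α : Ty n} (L : S.Lang α)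
    (Δ : Set ((S.extend D).Tm Ty.t)) (P : (S.extend D).Tm (Ty.s ⇒ α ⇒ Ty.t)) : Prop :=
  L.RepresentedBy Δ P ∧
    (∀ w : List (Fin N), ∃ l : List (S.Tm α),
      (S.extend D).Derives Δ
        (.eq (.app P ((S.extend D).wordTm w)) (Term.eqAny (l.map (S.incl D))))) ∧
    S.Conservative Δ

/-! ## Context instantiation -/

/-- `CI(C_c)`, that is `λ x_{cc}, λ y_{cα}, (= y_{cα} C_c)`. -/
def ciTm {α : Ty n} (C : S.Tm Ty.c) :
    S.Tm ((Ty.c ⇒ Ty.c) ⇒ (Ty.c ⇒ α) ⇒ α ⇒ Ty.t) :=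
  .lam (.lam (Term.eqTo (.app (.bvar .zero) C.lift)))

/-- Under the identification of `c(c × α)` with `(cc) × (cα)`, and of functions of a pair with
functions of two arguments, a term `R` of type `(cc)(cα)β` is a term of type `c(c × α)β`, namely
`λ p, R (λ z_c, π₁ (p z_c)) (λ z_c, π₂ (p z_c))`. -/
def uncurryCtx {α β : Ty n} (R : S.Tm ((Ty.c ⇒ Ty.c) ⇒ (Ty.c ⇒ α) ⇒ β)) :
    S.Tm (Ty.ctx α ⇒ β) :=
  .lam (.app (.app R.lift
    (.lam (.fst (.app (.bvar (.succ .zero)) (.bvar .zero)))))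
    (.lam (.snd (.app (.bvar (.succ .zero)) (.bvar .zero)))))

/-- The context instantiation of a context-dependent language: application of the semantic rule
that is represented by `CI(C_c)`. -/
def CtxLang.instantiate {α : Ty n} (L : S.CtxLang α) (C : S.Tm Ty.c) : S.Lang α :=
  Lang.applyRule L (SemRule.ofTerm (uncurryCtx (ciTm C)))

/-- The term of type `c(c × α)` that corresponds to the pair of `x_{cc}` and `y_{cα}`:
`λ z_c, (x z_c, y z_c)`. -/
def pairCtx {Γ : List (Ty n)} {α : Ty n} (x : Term S.Const Γ (Ty.c ⇒ Ty.c))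
    (y : Term S.Const Γ (Ty.c ⇒ α)) : Term S.Const Γ (Ty.ctx α) :=
  .lam (.pair (.app x.weaken (.bvar .zero)) (.app y.weaken (.bvar .zero)))

variable (S) in
/-- The instantiation operator, of type `(s(c(c × α))t)csαt`:
`λ z, λ z_c, λ x_s, λ y_α, ∃ x_{cc}, ∃ y_{cα}, (z x_s (x_{cc}, y_{cα}) ∧ y_α = y_{cα} z_c)`. -/
def dnOp (α : Ty n) :
    S.Tm ((Ty.s ⇒ Ty.ctx α ⇒ Ty.t) ⇒ Ty.c ⇒ Ty.s ⇒ α ⇒ Ty.t) :=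
  .lam (.lam (.lam (.lam (.ex (Ty.c ⇒ Ty.c) (.ex (Ty.c ⇒ α) (.and
    (.app
      (.app (.bvar (.succ (.succ (.succ (.succ (.succ .zero))))))
        (.bvar (.succ (.succ (.succ .zero)))))
      (pairCtx (.bvar (.succ .zero)) (.bvar .zero)))
    (.eq (.bvar (.succ (.succ .zero)))
      (.app (.bvar .zero) (.bvar (.succ (.succ (.succ (.succ .zero)))))))))))))

/-- The term `P ↓ C_c`, that is the instantiation operator applied to `P` and `C_c`. -/
def dnTm {α : Ty n} (P : S.Tm (Ty.s ⇒ Ty.ctx α ⇒ Ty.t)) (C : S.Tm Ty.c) :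
    S.Tm (Ty.s ⇒ α ⇒ Ty.t) :=
  .app (.app (S.dnOp α) P) C

end Sig

end TyN

/-!
The meaning of a pair `(x, y)` in the context `C` is `y C`, a function of the pair, so context
instantiation takes images along a function term `F`.  If `L w` is provably the finite disjunction
of the predicates `(= aᵢ)`, then its image along `F` is provably that of the predicates `(= F aᵢ)`.
By conservativity, membership of `(w, A)` in a language and of `(w, B)` in its image then become
provability of `⋁ᵢ A = aᵢ` and of `⋁ᵢ B = F aᵢ` in the theory without `Δ`.  It remains to find, for
a `B` that provably satisfies the second disjunction, one term `A` that provably satisfies the first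
and has `F A = B`, although no single disjunct need be provable: the description operator
defines conditional terms, and the first `aᵢ` with `B = F aᵢ` serves as `A`.
-/

namespace TyN

namespace Term

variable {n : ℕ} {K : Ty n → Type u} {Γ Δ Θ : List (Ty n)} {α β : Ty n}

/-! ### Substitution calculus -/

attribute [simp] rename subst inst mapConst liftRen liftSubst instSubst

theorem rename_rename (a : Term K Γ α) (ρ : ∀ α : Ty n, BVar Γ α → BVar Δ α)
    (τ : ∀ α : Ty n, BVar Δ α → BVar Θ α) :
    (a.rename ρ).rename τ = a.rename fun _ x => τ _ (ρ _ x) := by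
  induction a generalizing Δ Θ with
  | lam b ih =>
    simp only [rename, ih]
    congr 2
    funext _ x
    cases x <;> rfl
  | _ => simp only [rename, *]

theorem subst_rename (a : Term K Γ α) (ρ : ∀ α : Ty n, BVar Γ α → BVar Δ α)
    (σ : ∀ α : Ty n, BVar Δ α → Term K Θ α) :
    (a.rename ρ).subst σ = a.subst fun _ x => σ _ (ρ _ x) := by
  induction a generalizing Δ Θ with
  | lam b ih =>
    simp only [rename, subst, ih]
    congr 2
    funext _ x
    cases x <;> rfl
  | _ => simp only [rename, subst, *]

theorem rename_subst (a : Term K Γ α) (σ : ∀ α : Ty n, BVar Γ α → Term K Δ α)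
    (ρ : ∀ α : Ty n, BVar Δ α → BVar Θ α) :
    (a.subst σ).rename ρ = a.subst fun _ x => (σ _ x).rename ρ := by
  induction a generalizing Δ Θ with
  | lam b ih =>
    simp only [rename, subst, ih]
    congr 2
    funext _ x
    cases x <;> simp [weaken, rename_rename]
  | _ => simp only [rename, subst, *]

theorem subst_bvar (a : Term K Γ α) : (a.subst fun _ x => .bvar x) = a := by
  induction a with
  | @lam Γ α _ b ih =>
    have lift_id : liftSubst (K := K) (fun _ (x : BVar Γ _) => .bvar x) α = fun _ x => .bvar x := by
      funext _ x
      cases x <;> rfl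
    simp only [subst, lift_id, ih]
  | _ => simp only [subst, *]

theorem rename_eq_subst (a : Term K Γ α) (ρ : ∀ α : Ty n, BVar Γ α → BVar Δ α) :
    a.rename ρ = a.subst fun _ x => .bvar (ρ _ x) := by
  rw [← subst_bvar (a.rename ρ), subst_rename]

theorem weaken_eq_subst (a : Term K Γ α) :
    (a.weaken : Term K (β :: Γ) α) = a.subst fun _ x => .bvar (.succ x) :=
  rename_eq_subst a _

@[simp] theorem weaken_subst_liftSubst (a : Term K Γ α) (σ : ∀ α : Ty n, BVar Γ α → Term K Δ α) :
    (a.weaken (β := β)).subst (liftSubst σ β) = (a.subst σ).weaken := by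
  simp only [weaken, subst_rename, rename_subst, liftSubst]

@[simp] theorem weaken_subst_instSubst (a : Term K Γ α) (b : Term K Γ β) :
    a.weaken.subst (instSubst b) = a := by
  simp only [weaken, subst_rename, instSubst, subst_bvar]

@[simp] theorem weaken_bvar (x : BVar Γ α) :
    (bvar x : Term K Γ α).weaken (β := β) = bvar x.succ := rfl

@[simp] theorem weaken_app {γ : Ty n} (f : Term K Γ (α ⇒ β)) (a : Term K Γ α) :
    (app f a).weaken (β := γ) = app f.weaken a.weaken := rfl

@[simp] theorem lift_subst (a : Term K [] α) (σ : ∀ α : Ty n, BVar Γ α → Term K Δ α) :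
    a.lift.subst σ = a.lift := by
  rw [lift, subst_rename, lift, rename_eq_subst]
  congr 1
  funext _ x
  cases x

@[simp] theorem lift_nil (a : Term K [] α) : (a.lift : Term K [] α) = a := by
  rw [lift, rename_eq_subst]
  convert subst_bvar a using 2
  funext _ x
  cases x

@[simp] theorem mapConst_weaken {K' : Ty n → Type v} (f : ∀ α : Ty n, K α → K' α)
    (a : Term K Γ α) : (a.weaken (β := β)).mapConst f = (a.mapConst f).weaken := by
  have mapConst_rename {Γ Δ : List (Ty n)} {α : Ty n} (a : Term K Γ α)
      (ρ : ∀ α : Ty n, BVar Γ α → BVar Δ α) :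
      (a.rename ρ).mapConst f = (a.mapConst f).rename ρ := by
    induction a generalizing Δ <;> simp only [rename, mapConst, *]
  exact mapConst_rename a _

/-! ### Connectives and finite disjunctions -/

/-- Implication, expressed as the equation `(a ∧ b) = a`. -/
def imp (a b : Term K Γ Ty.t) : Term K Γ Ty.t := .eq (and a b) a

section Subst

variable (σ : ∀ α : Ty n, BVar Γ α → Term K Δ α)

@[simp] theorem tt_subst : (tt : Term K Γ Ty.t).subst σ = tt := rfl

@[simp] theorem neg_subst (a : Term K Γ Ty.t) : (neg a).subst σ = neg (a.subst σ) := rfl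

@[simp] theorem and_subst (a b : Term K Γ Ty.t) :
    (and a b).subst σ = and (a.subst σ) (b.subst σ) := by
  simp [and]

@[simp] theorem or_subst (a b : Term K Γ Ty.t) : (or a b).subst σ = or (a.subst σ) (b.subst σ) := by
  simp [or]

@[simp] theorem imp_subst (a b : Term K Γ Ty.t) :
    (imp a b).subst σ = imp (a.subst σ) (b.subst σ) := by
  simp [imp]

@[simp] theorem ex_subst (a : Term K (α :: Γ) Ty.t) :
    (ex α a).subst σ = ex α (a.subst (liftSubst σ α)) := by
  simp [ex, all]

@[simp] theorem eqTo_subst (a : Term K Γ α) : (eqTo a).subst σ = eqTo (a.subst σ) := by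
  simp [eqTo]

@[simp] theorem predOr_subst (p q : Term K Γ (α ⇒ Ty.t)) :
    (predOr p q).subst σ = predOr (p.subst σ) (q.subst σ) := by
  simp [predOr]

end Subst

theorem eqAny_cons (a : Term K Γ α) (l : List (Term K Γ α)) :
    eqAny (a :: l) = predOr (eqTo a) (eqAny l) := rfl

@[simp] theorem weaken_eqAny (l : List (Term K Γ α)) :
    (eqAny l).weaken (β := β) = eqAny (l.map weaken) := by
  induction l with
  | nil => rfl
  | cons a l ih =>
    rw [weaken_eq_subst] at ih
    rw [weaken_eq_subst, eqAny_cons, predOr_subst, ih, eqTo_subst, ← weaken_eq_subst, List.map_cons,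
      eqAny_cons]

theorem map_app_weaken {γ : Ty n} (F : Term K Γ (α ⇒ β)) (l : List (Term K Γ α)) :
    (l.map (app F)).map (weaken (β := γ)) = (l.map weaken).map (app F.weaken) := by
  simp

@[simp] theorem mapConst_eqAny {K' : Ty n → Type v} (f : ∀ α : Ty n, K α → K' α)
    (l : List (Term K Γ α)) : (eqAny l).mapConst f = eqAny (l.map (mapConst f)) := by
  induction l with
  | nil => rfl
  | cons a l ih =>
    simp only [eqAny_cons, List.map_cons, ← ih]
    simp [predOr, eqTo, or, neg, and, ff, tt, -weaken_eqAny]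

end Term

namespace Prov

open Term

variable {n : ℕ} {K : Ty n → Type u} {Γ : List (Ty n)} {H H' : List (Term K Γ Ty.t)}
  {α β : Ty n} {A B G : Term K Γ Ty.t}

theorem mono (h : Prov H A) (hs : H ⊆ H') : Prov H' A := by
  induction h with
  | hyp h => exact hyp (hs h)
  | refl a => exact refl a
  | leibniz P _ _ ih ih' => exact leibniz P (ih hs) (ih' hs)
  | xi _ ih => exact xi (ih (List.map_subset _ hs))
  | beta a b => exact beta a b
  | eta f => exact eta f
  | propExt _ _ ih ih' =>
    exact propExt (ih (List.cons_subset_cons _ hs)) (ih' (List.cons_subset_cons _ hs))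
  | boolCases P A _ _ ih ih' => exact boolCases P A (ih hs) (ih' hs)
  | fst_pair a b => exact fst_pair a b
  | snd_pair a b => exact snd_pair a b
  | pair_eta p => exact pair_eta p
  | descr a => exact descr a

theorem weak (h : Prov H A) : Prov (B :: H) A := h.mono (List.subset_cons_self _ _)

theorem head : Prov (A :: H) A := hyp List.mem_cons_self

/-! ### Equality -/

theorem beta_of_eq {a : Term K (α :: Γ) β} {b : Term K Γ α} {c : Term K Γ β} (h : a.inst b = c) :
    Prov H (.eq (.app (.lam a) b) c) := h ▸ beta a b

theorem app_weaken_lam {H : List (Term K (α :: Γ) Ty.t)} (b : Term K (α :: Γ) β) :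
    Prov H (.eq (.app b.lam.weaken (.bvar .zero)) b) := by
  refine beta_of_eq (a := b.rename (liftRen (fun _ x => .succ x) α)) ?_
  rw [inst, subst_rename]
  convert subst_bvar b using 2
  funext _ x
  cases x <;> rfl

theorem congr {a b : Term K Γ α} (f : Term K (α :: Γ) β) (h : Prov H (.eq a b)) :
    Prov H (.eq (f.inst a) (f.inst b)) := by
  have := leibniz (.eq (f.inst a).weaken f) h
  simp only [inst, subst, weaken_subst_instSubst] at this
  exact this (refl _)

theorem eq_mp (h : Prov H (.eq A B)) (hA : Prov H A) : Prov H B := leibniz (.bvar .zero) h hA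

theorem symm {a b : Term K Γ α} (h : Prov H (.eq a b)) : Prov H (.eq b a) := by
  have : Prov H (.eq (.eq a a) (.eq b a)) := by
    simpa using congr (.eq (.bvar .zero) a.weaken) h
  exact this.eq_mp (refl a)

theorem trans {a b c : Term K Γ α} (h : Prov H (.eq a b)) (h' : Prov H (.eq b c)) :
    Prov H (.eq a c) := by
  have : Prov H (.eq (.eq a b) (.eq a c)) := by
    simpa using congr (.eq a.weaken (.bvar .zero)) h'
  exact this.eq_mp h

theorem eq_mpr (h : Prov H (.eq A B)) (hB : Prov H B) : Prov H A := h.symm.eq_mp hB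

theorem app_arg (f : Term K Γ (α ⇒ β)) {a b : Term K Γ α} (h : Prov H (.eq a b)) :
    Prov H (.eq (.app f a) (.app f b)) := by
  simpa using congr (.app f.weaken (.bvar .zero)) h

theorem app_fun {f g : Term K Γ (α ⇒ β)} (h : Prov H (.eq f g)) (a : Term K Γ α) :
    Prov H (.eq (.app f a) (.app g a)) := by
  simpa using congr (.app (.bvar .zero) a.weaken) h

theorem eq_right (a : Term K Γ α) {b c : Term K Γ α} (h : Prov H (.eq b c)) :
    Prov H (.eq (.eq a b) (.eq a c)) := by
  simpa using congr (.eq a.weaken (.bvar .zero)) h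

theorem snd_congr {a b : Term K Γ (α ⊠ β)} (h : Prov H (.eq a b)) :
    Prov H (.eq (.snd a) (.snd b)) := by
  simpa using congr (.snd (.bvar .zero)) h

theorem pair_congr {a a' : Term K Γ α} {b b' : Term K Γ β} (h : Prov H (.eq a a'))
    (h' : Prov H (.eq b b')) : Prov H (.eq (.pair a b) (.pair a' b')) := by
  have left : Prov H (.eq (.pair a b) (.pair a' b)) := by
    simpa using congr (.pair (.bvar .zero) b.weaken) h
  have right : Prov H (.eq (.pair a' b) (.pair a' b')) := by
    simpa using congr (.pair a'.weaken (.bvar .zero)) h'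
  exact left.trans right

theorem funext {f g : Term K Γ (α ⇒ β)}
    (h : Prov (H.map weaken) (.eq (.app f.weaken (.bvar .zero)) (.app g.weaken (.bvar .zero)))) :
    Prov H (.eq f g) :=
  (eta f).symm.trans ((xi h).trans (eta g))

theorem predExt {p q : Term K Γ (α ⇒ Ty.t)}
    (h : Prov (.app p.weaken (.bvar .zero) :: H.map weaken) (.app q.weaken (.bvar .zero)))
    (h' : Prov (.app q.weaken (.bvar .zero) :: H.map weaken) (.app p.weaken (.bvar .zero))) :
    Prov H (.eq p q) :=
  funext (propExt h h')

/-! ### Propositional logic -/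

theorem tt_intro : Prov H .tt := refl _

theorem eq_tt (h : Prov H A) : Prov H (.eq A .tt) := propExt tt_intro h.weak

theorem and_intro (hA : Prov H A) (hB : Prov H B) : Prov H (.and A B) := by
  have left : Prov H (.eq (.and A B) (.and .tt B)) := by
    simpa using congr (.and (.bvar .zero) B.weaken) hA.eq_tt
  have right : Prov H (.eq (.and .tt B) (.and .tt .tt)) := by
    simpa using congr (.and .tt (.bvar .zero)) hB.eq_tt
  exact (left.trans right).eq_mpr (refl _)

-- A conjunction is the equation `(λ g, g T T) = (λ g, g A B)`; apply both sides to `g`.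
theorem app_app_eq_of_and (g : Term K Γ (Ty.t ⇒ Ty.t ⇒ Ty.t)) (h : Prov H (.and A B)) :
    Prov H (.eq (.app (.app g .tt) .tt) (.app (.app g A) B)) := by
  have eval (A B : Term K Γ Ty.t) :
      Prov H (.eq (.app (.lam (.app (.app (.bvar .zero) A.weaken) B.weaken)) g)
        (.app (.app g A) B)) := beta_of_eq (by simp)
  exact (eval .tt .tt).symm.trans ((app_fun h g).trans (eval A B))

theorem and_left (h : Prov H (.and A B)) : Prov H A := by
  have eval (A B : Term K Γ Ty.t) :
      Prov H (.eq (.app (.app (.lam (.lam (.bvar (.succ .zero)))) A) B) A) :=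
    (app_fun (beta _ A) B).trans (beta_of_eq (by simp))
  exact ((eval _ _).symm.trans ((h.app_app_eq_of_and _).trans (eval A B))).eq_mp tt_intro

theorem and_right (h : Prov H (.and A B)) : Prov H B := by
  have eval (A B : Term K Γ Ty.t) :
      Prov H (.eq (.app (.app (.lam (.lam (.bvar .zero))) A) B) B) :=
    (app_fun (beta _ A) B).trans (beta_of_eq (by simp))
  exact ((eval _ _).symm.trans ((h.app_app_eq_of_and _).trans (eval A B))).eq_mp tt_intro

theorem imp_intro (h : Prov (A :: H) B) : Prov H (.imp A B) :=
  propExt head.and_left (and_intro head h)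

theorem imp_elim (h : Prov H (.imp A B)) (hA : Prov H A) : Prov H B := (eq_mpr h hA).and_right

theorem cut (h : Prov H A) (h' : Prov (A :: H) B) : Prov H B := h'.imp_intro.imp_elim h

theorem ff_elim (h : Prov H .ff) : Prov H A := by
  have tt_eq : Prov H (.eq .tt A) :=
    (beta .tt A).symm.trans ((app_fun h A).trans (beta (.bvar .zero) A))
  exact tt_eq.eq_mp tt_intro

theorem neg_intro (h : Prov (A :: H) .ff) : Prov H (.neg A) := propExt h head.ff_elim

theorem neg_elim (h : Prov H (.neg A)) (hA : Prov H A) : Prov H B := (eq_mp h hA).ff_elim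

theorem by_cases (A : Term K Γ Ty.t) (h : Prov (A :: H) B) (h' : Prov (.neg A :: H) B) :
    Prov H B := by
  have cases_imp : Prov H (.imp (.imp A B) (.imp (.imp (.neg A) B) B)) := by
    have := boolCases (H := H) (.imp (.imp (.bvar .zero) B.weaken)
      (.imp (.imp (.neg (.bvar .zero)) B.weaken) B.weaken)) A
    simp only [inst, subst, imp_subst, neg_subst, weaken_subst_instSubst, instSubst] at this
    exact this (imp_intro (imp_intro (head.weak.imp_elim tt_intro)))
      (imp_intro (imp_intro (head.imp_elim (refl _))))
  exact (cases_imp.imp_elim h.imp_intro).imp_elim h'.imp_intro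

theorem or_left (h : Prov H A) : Prov H (.or A B) := neg_intro (head.and_left.neg_elim h.weak)

theorem or_right (h : Prov H B) : Prov H (.or A B) := neg_intro (head.and_right.neg_elim h.weak)

theorem or_elim (h : Prov H (.or A B)) (hA : Prov (A :: H) G) (hB : Prov (B :: H) G) :
    Prov H G := by
  refine by_cases A hA (by_cases B ?_ ?_)
  · exact hB.mono (List.cons_subset_cons _ (List.subset_cons_self _ _))
  · exact neg_elim h.weak.weak (and_intro head.weak head)

/-! ### Quantifiers -/

theorem ex_intro {A : Term K (α :: Γ) Ty.t} (b : Term K Γ α) (h : Prov H (A.inst b)) :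
    Prov H (.ex α A) := by
  refine neg_intro ?_
  have inst_neg : Prov (.all α (.neg A) :: H) (.eq .tt (.neg (A.inst b))) :=
    (beta .tt b).symm.trans ((app_fun head b).trans (beta (.neg A) b))
  exact (inst_neg.eq_mp tt_intro).neg_elim h.weak

theorem ex_elim {A : Term K (α :: Γ) Ty.t} (h : Prov H (.ex α A))
    (h' : Prov (A :: H.map weaken) G.weaken) : Prov H G := by
  refine by_cases G head (neg_elim h.weak (xi (eq_tt (neg_intro ?_)).symm))
  have hG : Prov (A :: (Term.neg G :: H).map weaken) (.neg G.weaken) := weak head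
  exact hG.neg_elim (h'.mono (List.cons_subset_cons _ (List.subset_cons_self _ _)))

/-! ### Finite disjunctions of the predicates `(= a)` -/

theorem app_eqTo (a b : Term K Γ α) : Prov H (.eq (.app (.eqTo a) b) (.eq b a)) :=
  beta_of_eq (by simp)

theorem app_predOr (p q : Term K Γ (α ⇒ Ty.t)) (b : Term K Γ α) :
    Prov H (.eq (.app (.predOr p q) b) (.or (.app p b) (.app q b))) :=
  beta_of_eq (by simp)

theorem eqAny_intro {l : List (Term K Γ α)} {a b : Term K Γ α} (ha : a ∈ l)
    (h : Prov H (.eq b a)) : Prov H (.app (.eqAny l) b) := by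
  induction l with
  | nil => simp at ha
  | cons c l ih =>
    refine (app_predOr _ _ b).eq_mpr ?_
    rcases List.mem_cons.1 ha with rfl | ha
    · exact or_left ((app_eqTo a b).eq_mpr h)
    · exact or_right (ih ha)

theorem eqAny_elim {l : List (Term K Γ α)} {b : Term K Γ α} (h : Prov H (.app (.eqAny l) b))
    (h' : ∀ a ∈ l, Prov (.eq b a :: H) G) : Prov H G := by
  induction l generalizing H with
  | nil => exact ((beta .ff b).eq_mp h).ff_elim
  | cons c l ih =>
    have weak_second {A B : Term K Γ Ty.t} (h : Prov (A :: H) G) : Prov (A :: B :: H) G :=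
      h.mono (List.cons_subset_cons _ (List.subset_cons_self _ _))
    refine ((app_predOr _ _ b).eq_mp h).or_elim ?_ (ih head fun a ha => ?_)
    · exact cut ((app_eqTo c b).eq_mp head) (weak_second (h' c List.mem_cons_self))
    · exact weak_second (h' a (List.mem_cons_of_mem _ ha))

end Prov

/-! ### Conditional terms and preimages under a function -/

namespace Term

variable {n : ℕ} {K : Ty n → Type u} {Γ Δ : List (Ty n)} {α β : Ty n}

/-- The term `if A then a else b`, that is `ι x_α, (A ∧ a = x_α) ∨ (¬ A ∧ b = x_α)`. -/
def ite (A : Term K Γ Ty.t) (a b : Term K Γ α) : Term K Γ α :=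
  .app .iota (.lam (.or (.and A.weaken (.eq a.weaken (.bvar .zero)))
    (.and (.neg A.weaken) (.eq b.weaken (.bvar .zero)))))

@[simp] theorem ite_subst (σ : ∀ α : Ty n, BVar Γ α → Term K Δ α) (A : Term K Γ Ty.t)
    (a b : Term K Γ α) : (ite A a b).subst σ = ite (A.subst σ) (a.subst σ) (b.subst σ) := by
  simp [ite]

/-- The first `a` in a list with `B = F a`, as a single term of the object language; the value
`x^0_α` for the case that there is none is irrelevant. -/
def firstPreimage (F : Term K Γ (α ⇒ β)) (B : Term K Γ β) (l : List (Term K Γ α)) : Term K Γ α :=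
  l.foldr (fun a A => ite (.eq B (.app F a)) a A) (.fvar 0)

end Term

namespace Prov

open Term

variable {n : ℕ} {K : Ty n → Type u} {Γ : List (Ty n)} {H : List (Term K Γ Ty.t)} {α β : Ty n}
  {A : Term K Γ Ty.t}

theorem ite_congr {A' : Term K Γ Ty.t} (h : Prov H (.eq A A')) (a b : Term K Γ α) :
    Prov H (.eq (.ite A a b) (.ite A' a b)) := by
  simpa using congr (.ite (.bvar .zero) a.weaken b.weaken) h

theorem ite_pos (h : Prov H A) (a b : Term K Γ α) : Prov H (.eq (.ite A a b) a) := by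
  have ite_tt : Prov H (.eq (.ite .tt a b) a) := by
    refine (app_arg .iota (xi (propExt ?_ ?_))).trans (descr a)
    · exact head.or_elim head.and_right (head.and_left.neg_elim tt_intro)
    · exact or_left (and_intro tt_intro head)
  exact (ite_congr h.eq_tt a b).trans ite_tt

theorem ite_neg (h : Prov H (.neg A)) (a b : Term K Γ α) : Prov H (.eq (.ite A a b) b) := by
  have ite_ff : Prov H (.eq (.ite .ff a b) b) := by
    refine (app_arg .iota (xi (propExt ?_ ?_))).trans (descr b)
    · exact head.or_elim head.and_left.ff_elim head.and_right
    · exact or_right (and_intro (refl _) head)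
  exact (ite_congr h a b).trans ite_ff

theorem firstPreimage_spec (F : Term K Γ (α ⇒ β)) {B : Term K Γ β} {l : List (Term K Γ α)}
    (h : Prov H (.app (.eqAny (l.map (.app F))) B)) :
    Prov H (.and (.app (.eqAny l) (.firstPreimage F B l))
      (.eq B (.app F (.firstPreimage F B l)))) := by
  induction l generalizing H with
  | nil => exact eqAny_elim h (by simp)
  | cons a l ih =>
    refine by_cases (.eq B (.app F a)) ?_ ?_
    · have h_first := ite_pos (H := .eq B (.app F a) :: H) head a (firstPreimage F B l)
      exact and_intro (eqAny_intro List.mem_cons_self h_first)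
        (head.trans (app_arg F h_first).symm)
    · have h_tail : Prov (.neg (.eq B (.app F a)) :: H) (.app (.eqAny (l.map (.app F))) B) :=
        ((app_predOr _ _ B).eq_mp h.weak).or_elim
          (head.weak.neg_elim ((app_eqTo _ B).eq_mp head)) head
      have h_first := ite_neg (H := .neg (.eq B (.app F a)) :: H) head a (firstPreimage F B l)
      refine and_intro ?_ ((ih h_tail).and_right.trans (app_arg F h_first).symm)
      exact (app_predOr _ _ _).eq_mpr (or_right ((app_arg _ h_first).eq_mpr (ih h_tail).and_left))

end Prov

/-! ### Images of predicates -/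

namespace Term

variable {n : ℕ} {K : Ty n → Type u} {Γ : List (Ty n)} {α β γ : Ty n}

/-- The image of the predicate `E` along `F`, that is `λ y_β, ∃ x_α, E x_α ∧ y_β = F x_α`. -/
def image (E : Term K Γ (α ⇒ Ty.t)) (F : Term K Γ (α ⇒ β)) : Term K Γ (β ⇒ Ty.t) :=
  .lam (.ex α (.and (.app E.weaken.weaken (.bvar .zero))
    (.eq (.bvar (.succ .zero)) (.app F.weaken.weaken (.bvar .zero)))))

@[simp] theorem image_subst {Δ : List (Ty n)} (σ : ∀ α : Ty n, BVar Γ α → Term K Δ α)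
    (E : Term K Γ (α ⇒ Ty.t)) (F : Term K Γ (α ⇒ β)) :
    (image E F).subst σ = image (E.subst σ) (F.subst σ) := by
  simp [image]

@[simp] theorem weaken_image (E : Term K Γ (α ⇒ Ty.t)) (F : Term K Γ (α ⇒ β)) :
    (image E F).weaken (β := γ) = image E.weaken F.weaken := by
  simp only [weaken_eq_subst, image_subst]

end Term

namespace Prov

open Term

variable {n : ℕ} {K : Ty n → Type u} {Γ : List (Ty n)} {H : List (Term K Γ Ty.t)} {α β : Ty n}
  {E E' : Term K Γ (α ⇒ Ty.t)} {F : Term K Γ (α ⇒ β)}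

theorem image_congr (h : Prov H (.eq E E')) (F : Term K Γ (α ⇒ β)) :
    Prov H (.eq (.image E F) (.image E' F)) := by
  simpa using congr (.image (.bvar .zero) F.weaken) h

theorem app_image (E : Term K Γ (α ⇒ Ty.t)) (F : Term K Γ (α ⇒ β)) (b : Term K Γ β) :
    Prov H (.eq (.app (.image E F) b) (.ex α (.and (.app E.weaken (.bvar .zero))
      (.eq b.weaken (.app F.weaken (.bvar .zero)))))) :=
  beta_of_eq (by simp)

theorem image_intro {a : Term K Γ α} {b : Term K Γ β} (ha : Prov H (.app E a))
    (hb : Prov H (.eq b (.app F a))) : Prov H (.app (.image E F) b) :=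
  (app_image E F b).eq_mpr (ex_intro a (by simpa using and_intro ha hb))

theorem image_elim {b : Term K Γ β} {G : Term K Γ Ty.t} (h : Prov H (.app (.image E F) b))
    (h' : Prov (.and (.app E.weaken (.bvar .zero)) (.eq b.weaken (.app F.weaken (.bvar .zero))) ::
      H.map weaken) G.weaken) : Prov H G :=
  ex_elim ((app_image E F b).eq_mp h) h'

theorem eqAny_map_app_of_image {l : List (Term K Γ α)} {b : Term K Γ β}
    (h : Prov H (.app (.image (.eqAny l) F) b)) :
    Prov H (.app (.eqAny (l.map (.app F))) b) := by
  refine image_elim h ?_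
  simp only [weaken_app, weaken_eqAny, map_app_weaken]
  refine eqAny_elim head.and_left fun a ha => ?_
  exact eqAny_intro (List.mem_map_of_mem ha) (head.weak.and_right.trans (app_arg _ head))

theorem image_of_eqAny_map_app {l : List (Term K Γ α)} {b : Term K Γ β}
    (h : Prov H (.app (.eqAny (l.map (.app F))) b)) :
    Prov H (.app (.image (.eqAny l) F) b) := by
  refine eqAny_elim h (List.forall_mem_map.2 fun a ha => ?_)
  exact image_intro (eqAny_intro ha (refl a)) head

theorem image_eqAny (l : List (Term K Γ α)) (F : Term K Γ (α ⇒ β)) :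
    Prov H (.eq (.image (.eqAny l) F) (.eqAny (l.map (.app F)))) := by
  apply predExt <;> simp only [weaken_image, weaken_eqAny, map_app_weaken]
  · exact eqAny_map_app_of_image head
  · exact image_of_eqAny_map_app head

end Prov

/-! ### Functional semantic rules -/

namespace Sig

open Term

variable {n N : ℕ} [Fact (2 < n)] {S : Sig.{u} n N} {α β : Ty n}

namespace Derives

variable {Δ : Set (S.Tm Ty.t)} {A B G : S.Tm Ty.t}

theorem of_prov (h : Prov [] A) : S.Derives Δ A := ⟨[], by simp, h⟩

theorem map (h : S.Derives Δ A) (f : ∀ {H : List (S.Tm Ty.t)}, Prov H A → Prov H B) :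
    S.Derives Δ B := by
  obtain ⟨H, hH, hA⟩ := h
  exact ⟨H, hH, f hA⟩

theorem map₂ (h : S.Derives Δ A) (h' : S.Derives Δ B)
    (f : ∀ {H : List (S.Tm Ty.t)}, Prov H A → Prov H B → Prov H G) : S.Derives Δ G := by
  obtain ⟨H, hH, hA⟩ := h
  obtain ⟨H', hH', hB⟩ := h'
  refine ⟨H ++ H', fun B hB => ?_, f (hA.mono (List.subset_append_left _ _))
    (hB.mono (List.subset_append_right _ _))⟩
  exact (List.mem_append.1 hB).elim (hH B) (hH' B)

theorem congr_iff (h : S.Derives Δ (.eq A B)) : S.Derives Δ A ↔ S.Derives Δ B :=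
  ⟨fun hA => h.map₂ hA Prov.eq_mp, fun hB => h.map₂ hB Prov.eq_mpr⟩

theorem eqAny_map_app_iff {l : List (S.Tm α)} {F : S.Tm (α ⇒ β)} {B : S.Tm β} :
    S.Derives Δ (.app (.eqAny (l.map (.app F))) B) ↔
      ∃ A : S.Tm α, S.Derives Δ (.app (.eqAny l) A) ∧ S.Derives Δ (.eq B (.app F A)) := by
  constructor
  · intro h
    have spec := h.map (Prov.firstPreimage_spec F)
    exact ⟨firstPreimage F B l, spec.map Prov.and_left, spec.map Prov.and_right⟩
  · rintro ⟨A, hA, hB⟩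
    exact hA.map₂ hB fun h h' => Prov.eqAny_map_app_of_image (Prov.image_intro h h')

end Derives

variable {D : Ty n → Type v} {Δ : Set ((S.extend D).Tm Ty.t)}

theorem Conservative.derives_app_iff (hΔ : S.Conservative Δ) {p : (S.extend D).Tm (α ⇒ Ty.t)}
    {l : List (S.Tm α)} (hp : (S.extend D).Derives Δ (.eq p (.eqAny (l.map (S.incl D)))))
    (A : S.Tm α) :
    (S.extend D).Derives Δ (.app p (S.incl D A)) ↔ S.Derives ∅ (.app (.eqAny l) A) := by
  have incl_app : S.incl D (.app (.eqAny l) A) = .app (.eqAny (l.map (S.incl D))) (S.incl D A) :=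
    congrArg (app · (S.incl D A)) (mapConst_eqAny _ l)
  rw [hΔ, incl_app]
  exact Derives.congr_iff (hp.map fun h => h.app_fun _)

theorem Lang.PseudoCanonic.applyRule {L : S.Lang α} {P : (S.extend D).Tm (Ty.s ⇒ α ⇒ Ty.t)}
    (hL : Lang.PseudoCanonic L Δ P) {R : S.Tm (α ⇒ β ⇒ Ty.t)} {F : S.Tm (α ⇒ β)}
    (hR : ∀ A B, S.Derives ∅ (.eq (.app (.app R A) B) (.eq B (.app F A))))
    {Q : (S.extend D).Tm (Ty.s ⇒ β ⇒ Ty.t)}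
    (hQ : ∀ w, (S.extend D).Derives Δ (.eq (.app Q ((S.extend D).wordTm w))
      (.image (.app P ((S.extend D).wordTm w)) (S.incl D F)))) :
    Lang.PseudoCanonic (L.applyRule (SemRule.ofTerm R)) Δ Q := by
  obtain ⟨⟨hcons, hrep⟩, hfin, hconv⟩ := hL
  have finite_image {w : List (Fin N)} {l : List (S.Tm α)} (hl : (S.extend D).Derives Δ
      (.eq (.app P ((S.extend D).wordTm w)) (.eqAny (l.map (S.incl D))))) :
      (S.extend D).Derives Δ (.eq (.app Q ((S.extend D).wordTm w))
        (.eqAny ((l.map (.app F)).map (S.incl D)))) := by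
    have map_incl : (l.map (.app F)).map (S.incl D)
        = (l.map (S.incl D)).map (.app (S.incl D F)) := by
      rw [List.map_map, List.map_map]
      rfl
    rw [map_incl]
    exact (hQ w).map₂ hl fun h h' => h.trans ((h'.image_congr _).trans (Prov.image_eqAny _ _))
  refine ⟨⟨hcons, fun w B => ?_⟩, fun w => ?_, hconv⟩
  · obtain ⟨l, hl⟩ := hfin w
    calc (w, B) ∈ L.applyRule (SemRule.ofTerm R)
      _ ↔ ∃ A, (w, A) ∈ L ∧ S.Derives ∅ (.app (.app R A) B) := Iff.rfl
      _ ↔ ∃ A, S.Derives ∅ (.app (.eqAny l) A) ∧ S.Derives ∅ (.eq B (.app F A)) := by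
        simp only [hrep, hconv.derives_app_iff hl, (hR _ B).congr_iff]
      _ ↔ S.Derives ∅ (.app (.eqAny (l.map (.app F))) B) := Derives.eqAny_map_app_iff.symm
      _ ↔ _ := (hconv.derives_app_iff (finite_image hl) B).symm
  · obtain ⟨l, hl⟩ := hfin w
    exact ⟨_, finite_image hl⟩

/-! ### Context instantiation -/

variable {Γ : List (Ty n)} {H : List (Term S.Const Γ Ty.t)}

@[simp] theorem pairCtx_subst {Θ : List (Ty n)} (σ : ∀ α : Ty n, BVar Γ α → Term S.Const Θ α)
    (x : Term S.Const Γ (Ty.c ⇒ Ty.c)) (y : Term S.Const Γ (Ty.c ⇒ α)) :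
    (pairCtx x y).subst σ = pairCtx (x.subst σ) (y.subst σ) := by
  simp [pairCtx]

/-- The first component `λ z_c, π₁ (p z_c)` of a term `p` of type `c(c × α)` in the identification
with pairs of terms of types `cc` and `cα`. -/
def ctxPart (p : Term S.Const Γ (Ty.ctx α)) : Term S.Const Γ (Ty.c ⇒ Ty.c) :=
  .lam (.fst (.app p.weaken (.bvar .zero)))

/-- The second component `λ z_c, π₂ (p z_c)` of a term `p` of type `c(c × α)` in the identification
with pairs of terms of types `cc` and `cα`. -/
def contentPart (p : Term S.Const Γ (Ty.ctx α)) : Term S.Const Γ (Ty.c ⇒ α) :=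
  .lam (.snd (.app p.weaken (.bvar .zero)))

/-- The function `λ p, π₂ (p C)` that evaluates the content part of `p` in the context `C`. -/
def evalAt (C : Term S.Const Γ Ty.c) : Term S.Const Γ (Ty.ctx α ⇒ α) :=
  .lam (.snd (.app (.bvar .zero) C.weaken))

@[simp] theorem weaken_evalAt (C : Term S.Const Γ Ty.c) :
    (evalAt (α := α) C).weaken (β := β) = evalAt C.weaken := by
  have evalAt_subst {Θ : List (Ty n)} (σ : ∀ α : Ty n, BVar Γ α → Term S.Const Θ α) :
      (evalAt (α := α) C).subst σ = evalAt (C.subst σ) := by simp [evalAt]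
  simp only [weaken_eq_subst, evalAt_subst]

theorem incl_evalAt (C : S.Tm Ty.c) :
    S.incl D (evalAt (α := α) C) = evalAt (S.incl D C) :=
  congrArg (fun c => lam (snd (app (bvar .zero) c))) (mapConst_weaken _ C)

theorem app_evalAt (C : Term S.Const Γ Ty.c) (p : Term S.Const Γ (Ty.ctx α)) :
    Prov H (.eq (.app (evalAt C) p) (.snd (.app p C))) :=
  Prov.beta_of_eq (by simp)

theorem app_contentPart (p : Term S.Const Γ (Ty.ctx α)) (C : Term S.Const Γ Ty.c) :
    Prov H (.eq (.app (contentPart p) C) (.app (evalAt C) p)) :=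
  (Prov.beta_of_eq (by simp)).trans (app_evalAt C p).symm

theorem app_evalAt_pairCtx (C : Term S.Const Γ Ty.c) (x : Term S.Const Γ (Ty.c ⇒ Ty.c))
    (y : Term S.Const Γ (Ty.c ⇒ α)) : Prov H (.eq (.app (evalAt C) (pairCtx x y)) (.app y C)) := by
  have app_pairCtx : Prov H (.eq (.app (pairCtx x y) C) (.pair (.app x C) (.app y C))) :=
    Prov.beta_of_eq (by simp)
  exact (app_evalAt C _).trans ((Prov.snd_congr app_pairCtx).trans (Prov.snd_pair _ _))

theorem pairCtx_ctxPart_contentPart (p : Term S.Const Γ (Ty.ctx α)) :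
    Prov H (.eq (pairCtx (ctxPart p) (contentPart p)) p) := by
  have eta_lam {β : Ty n} (b : Term S.Const (Ty.c :: Γ) β) :
      Prov (H.map weaken) (.eq (.app b.lam.weaken (.bvar .zero)) b) := Prov.app_weaken_lam b
  exact (Prov.xi ((Prov.pair_congr (eta_lam _) (eta_lam _)).trans (Prov.pair_eta _))).trans
    (Prov.eta p)

theorem app_uncurryCtx_ciTm {H : List (S.Tm Ty.t)} (C : S.Tm Ty.c) (A : S.Tm (Ty.ctx α))
    (B : S.Tm α) :
    Prov H (.eq (.app (.app (uncurryCtx (ciTm C)) A) B) (.eq B (.app (evalAt C) A))) := by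
  have uncurry : Prov H (.eq (.app (uncurryCtx (ciTm C)) A)
      (.app (.app (ciTm C) (ctxPart A)) (contentPart A))) :=
    Prov.beta_of_eq (by simp [ctxPart, contentPart])
  have apply_left : Prov H (.eq (.app (ciTm (α := α) C) (ctxPart A))
      (.lam (.eqTo (.app (.bvar .zero) C.lift)))) := Prov.beta_of_eq (by simp)
  have apply_right : Prov H (.eq (.app (.lam (.eqTo (.app (.bvar .zero) C.lift))) (contentPart A))
      (.eqTo (.app (contentPart A) C))) := Prov.beta_of_eq (by simp)
  exact ((uncurry.trans ((apply_left.app_fun _).trans apply_right)).app_fun B).trans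
    ((Prov.app_eqTo _ B).trans (Prov.eq_right B (app_contentPart A C)))

/-- The predicate `λ y_α, ∃ x_{cc}, ∃ y_{cα}, E (x_{cc}, y_{cα}) ∧ y_α = y_{cα} C`, which is the
value of `P ↓ C` at a word if `E` is the value of `P`. -/
def dnPred (E : Term S.Const Γ (Ty.ctx α ⇒ Ty.t)) (C : Term S.Const Γ Ty.c) :
    Term S.Const Γ (α ⇒ Ty.t) :=
  .lam (.ex (Ty.c ⇒ Ty.c) (.ex (Ty.c ⇒ α) (.and
    (.app E.weaken.weaken.weaken (pairCtx (.bvar (.succ .zero)) (.bvar .zero)))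
    (.eq (.bvar (.succ (.succ .zero))) (.app (.bvar .zero) C.weaken.weaken.weaken)))))

@[simp] theorem dnPred_subst {Θ : List (Ty n)} (σ : ∀ α : Ty n, BVar Γ α → Term S.Const Θ α)
    (E : Term S.Const Γ (Ty.ctx α ⇒ Ty.t)) (C : Term S.Const Γ Ty.c) :
    (dnPred E C).subst σ = dnPred (E.subst σ) (C.subst σ) := by
  simp [dnPred]

@[simp] theorem weaken_dnPred (E : Term S.Const Γ (Ty.ctx α ⇒ Ty.t)) (C : Term S.Const Γ Ty.c) :
    (dnPred E C).weaken (β := β) = dnPred E.weaken C.weaken := by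
  simp only [weaken_eq_subst, dnPred_subst]

theorem app_dnTm {H : List (S.Tm Ty.t)} (P : S.Tm (Ty.s ⇒ Ty.ctx α ⇒ Ty.t)) (C : S.Tm Ty.c)
    (w : S.Tm Ty.s) : Prov H (.eq (.app (dnTm P C) w) (dnPred (.app P w) C)) := by
  have apply_rep : Prov H (.eq (.app (S.dnOp α) P)
      (.lam (.lam (dnPred (.app P.weaken.weaken (.bvar .zero)) (.bvar (.succ .zero)))))) :=
    Prov.beta_of_eq (a := .lam (.lam (dnPred (.app (.bvar (.succ (.succ .zero))) (.bvar .zero))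
      (.bvar (.succ .zero))))) (by simp)
  have apply_ctx : Prov H (.eq
      (.app (.lam (.lam (dnPred (.app P.weaken.weaken (.bvar .zero)) (.bvar (.succ .zero))))) C)
      (.lam (dnPred (.app P.weaken (.bvar .zero)) C.weaken))) := Prov.beta_of_eq (by simp)
  have apply_word : Prov H (.eq (.app (.lam (dnPred (.app P.weaken (.bvar .zero)) C.weaken)) w)
      (dnPred (.app P w) C)) := Prov.beta_of_eq (by simp)
  exact (((apply_rep.app_fun C).trans apply_ctx).app_fun w).trans apply_word

variable {E : Term S.Const Γ (Ty.ctx α ⇒ Ty.t)} {C : Term S.Const Γ Ty.c} {b : Term S.Const Γ α}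

theorem app_dnPred (E : Term S.Const Γ (Ty.ctx α ⇒ Ty.t)) (C : Term S.Const Γ Ty.c)
    (b : Term S.Const Γ α) :
    Prov H (.eq (.app (dnPred E C) b) (.ex (Ty.c ⇒ Ty.c) (.ex (Ty.c ⇒ α) (.and
      (.app E.weaken.weaken (pairCtx (.bvar (.succ .zero)) (.bvar .zero)))
      (.eq b.weaken.weaken (.app (.bvar .zero) C.weaken.weaken)))))) :=
  Prov.beta_of_eq (by simp)

theorem image_evalAt_of_dnPred (h : Prov H (.app (dnPred E C) b)) :
    Prov H (.app (.image E (evalAt C)) b) := by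
  refine Prov.ex_elim ((app_dnPred E C b).eq_mp h) (Prov.ex_elim Prov.head ?_)
  simp only [weaken_app, weaken_image, weaken_evalAt]
  exact Prov.image_intro Prov.head.and_left
    (Prov.head.and_right.trans (app_evalAt_pairCtx _ _ _).symm)

theorem dnPred_intro (p : Term S.Const Γ (Ty.ctx α)) (hp : Prov H (.app E p))
    (hb : Prov H (.eq b (.app (evalAt C) p))) : Prov H (.app (dnPred E C) b) := by
  refine (app_dnPred E C b).eq_mpr
    (Prov.ex_intro (ctxPart p) (Prov.ex_intro (contentPart p) ?_))
  have h_pair : Prov H (.app E (pairCtx (ctxPart p) (contentPart p))) :=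
    (Prov.app_arg E (pairCtx_ctxPart_contentPart p)).eq_mpr hp
  simpa using Prov.and_intro h_pair (hb.trans (app_contentPart p C).symm)

theorem dnPred_of_image_evalAt (h : Prov H (.app (.image E (evalAt C)) b)) :
    Prov H (.app (dnPred E C) b) := by
  refine Prov.image_elim h ?_
  simp only [weaken_app, weaken_dnPred, weaken_evalAt]
  exact dnPred_intro _ Prov.head.and_left Prov.head.and_right

theorem dnPred_eq_image (E : Term S.Const Γ (Ty.ctx α ⇒ Ty.t)) (C : Term S.Const Γ Ty.c) :
    Prov H (.eq (dnPred E C) (.image E (evalAt C))) := by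
  apply Prov.predExt <;> simp only [weaken_image, weaken_evalAt, weaken_dnPred]
  · exact image_evalAt_of_dnPred Prov.head
  · exact dnPred_of_image_evalAt Prov.head

end Sig

end TyN

theorem proposition9p3 {n N : ℕ} [Fact (2 < n)] (S : TyN.Sig.{u} n N)
    (D : TyN.Ty n → Type v) (α : TyN.Ty n) (L : S.CtxLang α)
    (Δ : Set ((S.extend D).Tm TyN.Ty.t))
    (P : (S.extend D).Tm (TyN.Ty.s ⇒ TyN.Ty.ctx α ⇒ TyN.Ty.t)) (C : S.Tm TyN.Ty.c)
    (hL : TyN.Sig.Lang.PseudoCanonic L Δ P) :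
    TyN.Sig.Lang.PseudoCanonic (TyN.Sig.CtxLang.instantiate L C) Δ
      (TyN.Sig.dnTm P (S.incl D C)) :=
  hL.applyRule (F := TyN.Sig.evalAt C)
    (fun A B => .of_prov (TyN.Sig.app_uncurryCtx_ciTm C A B))
    (fun w => by
      rw [TyN.Sig.incl_evalAt]
      exact .of_prov ((TyN.Sig.app_dnTm P _ _).trans (TyN.Sig.dnPred_eq_image _ _)))
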